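/- For a complex $n\times n$ matrix $x$ with no eigenvalue in $]-\infty,0]$, let $\log(x)$ denote its principal logarithm, i.e. the unique complex $n\times n$ matrix $a$ such that $e^{a}=x$ and every eigenvalue $z$ of $a$ satisfies $-\pi<\operatorname{Im}(z)<\pi$. Let $x,y$ be $2\times 2$ complex matrices such that none of $x$, $y$, $xy$ has an eigenvalue in $]-\infty,0]$, and suppose that $\log(xy)=\log(x)+\log(y)$. Then $x$ and $y$ commute, i.e. $xy=yx$. -/

import Mathlib

/-- The matrix `x` has no eigenvalue in the half-line `]-∞, 0]`. -/
def NoNonposEigenvalue {n : ℕ} (x : Matrix (Fin n) (Fin n) ℂ) : Prop :=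
  ∀ t : ℝ, t ≤ 0 → (t : ℂ) ∉ spectrum ℂ x

/-- `a` is a principal logarithm of `x`: `e ^ a = x` and every eigenvalue of `a` lies in the open
strip `-π < Im z < π`. -/
def IsPrincipalLog {n : ℕ} (x a : Matrix (Fin n) (Fin n) ℂ) : Prop :=
  NormedSpace.exp a = x ∧ ∀ z ∈ spectrum ℂ a, z.im ∈ Set.Ioo (-Real.pi) Real.pi

open Classical in
/-- The principal logarithm of `x` (and `0` when `x` has none). -/
noncomputable def matrixLog {n : ℕ} (x : Matrix (Fin n) (Fin n) ℂ) : Matrix (Fin n) (Fin n) ℂ :=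
  if h : ∃ a, IsPrincipalLog x a then h.choose else 0

namespace MatrixLog

lemma spec_pair (a : Matrix (Fin 2) (Fin 2) ℂ) :
    ∃ p ∈ spectrum ℂ a, ∃ q ∈ spectrum ℂ a, (a - p • 1) * (a - q • 1) = 0 := by
  obtain ⟨p, hp⟩ := spectrum.nonempty_of_isAlgClosed_of_finiteDimensional ℂ a
  have key : ∀ z : ℂ, z ∈ spectrum ℂ a ↔ (z - a 0 0) * (z - a 1 1) - a 0 1 * a 1 0 = 0 := by
    intro z
    rw [spectrum.mem_iff, Matrix.isUnit_iff_isUnit_det, isUnit_iff_ne_zero, not_not,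
      Matrix.det_fin_two]
    simp [Matrix.algebraMap_matrix_apply]
  rw [key] at hp
  refine ⟨p, (key p).2 hp, a 0 0 + a 1 1 - p, (key _).2 ?_, ?_⟩
  · linear_combination hp
  · ext i j
    fin_cases i <;> fin_cases j <;> simp [Matrix.mul_apply, Fin.sum_univ_two]
    · linear_combination -hp
    · ring
    · ring
    · linear_combination -hp

lemma spec_sub {a : Matrix (Fin 2) (Fin 2) ℂ} {p q : ℂ}
    (h : (a - p • 1) * (a - q • 1) = 0) {z : ℂ} (hz : z ∈ spectrum ℂ a) : z = p ∨ z = q := by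
  by_contra hne
  push Not at hne
  have h0 : (z - p) * (z - q) ≠ 0 := mul_ne_zero (sub_ne_zero.2 hne.1) (sub_ne_zero.2 hne.2)
  have e : (z • (1 : Matrix (Fin 2) (Fin 2) ℂ) - a) * (a - (p + q - z) • 1)
      = ((z - p) * (z - q)) • 1 - (a - p • 1) * (a - q • 1) := by
    ext i j
    fin_cases i <;> fin_cases j <;> simp [Matrix.mul_apply, Fin.sum_univ_two] <;> ring
  rw [h, sub_zero] at e
  apply (spectrum.mem_iff.1 hz)
  rw [Algebra.algebraMap_eq_smul_one, Matrix.isUnit_iff_isUnit_det, isUnit_iff_ne_zero]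
  intro hd
  have := congrArg Matrix.det e
  rw [Matrix.det_mul, hd, zero_mul, Matrix.det_smul, Matrix.det_one] at this
  simp only [Fintype.card_fin, mul_one] at this
  exact pow_ne_zero 2 h0 this.symm

lemma hasSum_mexp (a : Matrix (Fin 2) (Fin 2) ℂ) :
    HasSum (fun n : ℕ => ((n.factorial : ℂ)⁻¹) • a ^ n) (NormedSpace.exp a) := by
  open scoped Matrix.Norms.Operator in
  exact NormedSpace.exp_series_hasSum_exp' (𝕂 := ℂ) a

lemma hasSum_cexp (p : ℂ) :
    HasSum (fun n : ℕ => ((n.factorial : ℂ)⁻¹) * p ^ n) (Complex.exp p) := by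
  have := NormedSpace.exp_series_hasSum_exp' (𝕂 := ℂ) p
  rw [← Complex.exp_eq_exp_ℂ] at this
  simpa using this

lemma exp_of_mul_eq_zero {a : Matrix (Fin 2) (Fin 2) ℂ} {p q : ℂ}
    (h : (a - p • 1) * (a - q • 1) = 0) :
    (p - q) • NormedSpace.exp a = Complex.exp p • (a - q • 1) - Complex.exp q • (a - p • 1) := by
  have ha : a * (a - q • 1) = p • (a - q • 1) := by
    rw [sub_mul, smul_mul_assoc, one_mul, sub_eq_zero] at h
    exact h
  have hb : a * (a - p • 1) = q • (a - p • 1) := by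
    have : (a - q • 1) * (a - p • 1) = 0 := by
      rw [← h]; simp only [sub_mul, mul_sub, smul_mul_assoc, mul_smul_comm, one_mul, mul_one,
        smul_sub, smul_smul, mul_comm p q]
      abel
    rw [sub_mul, smul_mul_assoc, one_mul, sub_eq_zero] at this
    exact this
  have hpow : ∀ n : ℕ, (p - q) • a ^ n = p ^ n • (a - q • 1) - q ^ n • (a - p • 1) := by
    intro n
    induction n with
    | zero => simp [sub_smul]
    | succ n ih =>
      rw [pow_succ', ← mul_smul_comm, ih, mul_sub, mul_smul_comm, mul_smul_comm, ha, hb,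
        smul_smul, smul_smul, pow_succ, pow_succ]
  have h1 := (hasSum_mexp a).const_smul (p - q)
  have h2 := ((hasSum_cexp p).smul_const (a - q • 1)).sub
    ((hasSum_cexp q).smul_const (a - p • 1))
  have hf : (fun n : ℕ => (p - q) • ((n.factorial : ℂ)⁻¹) • a ^ n) = fun n : ℕ =>
      ((n.factorial : ℂ)⁻¹ * p ^ n) • (a - q • 1) - ((n.factorial : ℂ)⁻¹ * q ^ n) • (a - p • 1) := by
    funext n
    rw [smul_comm, hpow, smul_sub, smul_smul, smul_smul]
  rw [hf] at h1
  exact h1.unique h2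

lemma exp_of_sq_eq_zero {a : Matrix (Fin 2) (Fin 2) ℂ} {p : ℂ}
    (h : (a - p • 1) * (a - p • 1) = 0) :
    NormedSpace.exp a = Complex.exp p • (1 + (a - p • 1)) := by
  set N := a - p • (1 : Matrix (Fin 2) (Fin 2) ℂ) with hN
  have ha : a = p • 1 + N := by simp [hN]
  have h1 : NormedSpace.exp (p • (1 : Matrix (Fin 2) (Fin 2) ℂ)) = Complex.exp p • 1 := by
    refine (hasSum_mexp _).unique ?_
    convert (hasSum_cexp p).smul_const (1 : Matrix (Fin 2) (Fin 2) ℂ) using 2 with n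
    rw [smul_pow, one_pow, smul_smul]
  have h2 : NormedSpace.exp N = 1 + N := by
    refine (hasSum_mexp N).unique ?_
    have := hasSum_sum_of_ne_finset_zero (f := fun n : ℕ => ((n.factorial : ℂ)⁻¹) • N ^ n)
      (s := Finset.range 2) (L := SummationFilter.unconditional ℕ) (by
        intro n hn
        have hn2 : 2 ≤ n := by
          rw [Finset.mem_range] at hn
          omega
        obtain ⟨k, rfl⟩ := Nat.exists_eq_add_of_le hn2
        rw [pow_add, pow_two, h, zero_mul, smul_zero])
    simpa [Finset.sum_range_succ] using this
  rw [ha, Matrix.exp_add_of_commute _ _ ((Commute.one_left N).smul_left p), h1, h2,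
    smul_mul_assoc, one_mul]

lemma mem_slit {x : Matrix (Fin 2) (Fin 2) ℂ} (hx : NoNonposEigenvalue x) {p : ℂ}
    (hp : p ∈ spectrum ℂ x) : p ∈ Complex.slitPlane := by
  by_contra hn
  rw [Complex.mem_slitPlane_iff] at hn
  push Not at hn
  refine hx p.re hn.1 ?_
  have : ((p.re : ℝ) : ℂ) = p := Complex.ext (by simp) (by simp [hn.2])
  rwa [this]

lemma log_strip {p : ℂ} (hp : p ∈ Complex.slitPlane) :
    (Complex.log p).im ∈ Set.Ioo (-Real.pi) Real.pi := by
  rw [Complex.log_im]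
  exact ⟨Complex.neg_pi_lt_arg p,
    lt_of_le_of_ne (Complex.arg_le_pi p) (Complex.slitPlane_arg_ne_pi hp)⟩

/-- A 2×2 matrix without eigenvalues in `]-∞, 0]` has a principal logarithm. -/
theorem exists_isPrincipalLog {x : Matrix (Fin 2) (Fin 2) ℂ} (hx : NoNonposEigenvalue x) :
    ∃ a, IsPrincipalLog x a := by
  obtain ⟨p, hp, q, hq, h⟩ := spec_pair x
  have hp' := mem_slit hx hp
  have hq' := mem_slit hx hq
  have ep := Complex.exp_log (Complex.slitPlane_ne_zero hp')
  have eq := Complex.exp_log (Complex.slitPlane_ne_zero hq')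
  by_cases hpq : p = q
  · subst hpq
    have p0 := Complex.slitPlane_ne_zero hp'
    have e : (Complex.log p • 1 + p⁻¹ • (x - p • 1)) - Complex.log p • 1
        = p⁻¹ • (x - p • 1) := by abel
    have h' : ((Complex.log p • 1 + p⁻¹ • (x - p • 1)) - Complex.log p • 1) *
        ((Complex.log p • 1 + p⁻¹ • (x - p • 1)) - Complex.log p • 1) = 0 := by
      rw [e, smul_mul_smul_comm, h, smul_zero]
    refine ⟨Complex.log p • 1 + p⁻¹ • (x - p • 1), ?_, ?_⟩
    · rw [exp_of_sq_eq_zero h', e, ep, smul_add, smul_smul, mul_inv_cancel₀ p0, one_smul]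
      abel
    · intro z hz
      rcases spec_sub h' hz with rfl | rfl <;> exact log_strip hp'
  · have d0 : p - q ≠ 0 := sub_ne_zero.2 hpq
    have hL : Complex.log p ≠ Complex.log q := fun hl => hpq (by rw [← ep, ← eq, hl])
    have D0 : Complex.log p - Complex.log q ≠ 0 := sub_ne_zero.2 hL
    set L := Complex.log p
    set M := Complex.log q
    set c := (L - M) / (p - q) with hc
    have e1 : (M • 1 + c • (x - q • 1)) - M • 1 = c • (x - q • 1) := by abel
    have e2 : (M • 1 + c • (x - q • 1)) - L • 1 = c • (x - p • 1) := by
      have : L = M + c * (p - q) := by rw [hc]; field_simp; ring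
      rw [this]
      module
    have h' : ((M • 1 + c • (x - q • 1)) - L • 1) * ((M • 1 + c • (x - q • 1)) - M • 1) = 0 := by
      rw [e1, e2, smul_mul_smul_comm, h, smul_zero]
    refine ⟨M • 1 + c • (x - q • 1), ?_, ?_⟩
    · have := exp_of_mul_eq_zero h'
      rw [e1, e2, ep, eq] at this
      have h3 : (L - M) • NormedSpace.exp (M • 1 + c • (x - q • 1)) = (L - M) • x := by
        rw [this]
        have : L - M = c * (p - q) := by rw [hc]; field_simp
        rw [this]
        module
      exact smul_right_injective _ D0 h3
    · intro z hz
      rcases spec_sub h' hz with rfl | rfl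
      · exact log_strip hp'
      · exact log_strip hq'

lemma strip_inj {p q : ℂ} (hp : p.im ∈ Set.Ioo (-Real.pi) Real.pi)
    (hq : q.im ∈ Set.Ioo (-Real.pi) Real.pi) (h : Complex.exp p = Complex.exp q) : p = q := by
  rw [← Complex.log_exp hp.1 hp.2.le, ← Complex.log_exp hq.1 hq.2.le, h]

lemma exp_spec {a : Matrix (Fin 2) (Fin 2) ℂ} {p : ℂ} (hp : p ∈ spectrum ℂ a) :
    Complex.exp p ∈ spectrum ℂ (NormedSpace.exp a) := by
  rw [Complex.exp_eq_exp_ℂ]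
  open scoped Matrix.Norms.Operator in
  exact spectrum.exp_mem_exp a hp

lemma exp_poly {a : Matrix (Fin 2) (Fin 2) ℂ} {p q : ℂ}
    (h : (a - p • 1) * (a - q • 1) = 0) :
    (NormedSpace.exp a - Complex.exp p • 1) * (NormedSpace.exp a - Complex.exp q • 1) = 0 := by
  by_cases hpq : p = q
  · subst hpq
    have : NormedSpace.exp a - Complex.exp p • 1 = Complex.exp p • (a - p • 1) := by
      rw [exp_of_sq_eq_zero h]; module
    rw [this, smul_mul_smul_comm, h, smul_zero]
  · have d0 : p - q ≠ 0 := sub_ne_zero.2 hpq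
    have h3 := exp_of_mul_eq_zero h
    have e1 : (p - q) • (NormedSpace.exp a - Complex.exp p • 1)
        = (Complex.exp p - Complex.exp q) • (a - p • 1) := by
      rw [smul_sub, h3]; module
    have e2 : (p - q) • (NormedSpace.exp a - Complex.exp q • 1)
        = (Complex.exp p - Complex.exp q) • (a - q • 1) := by
      rw [smul_sub, h3]; module
    have : ((p - q) * (p - q)) •
        ((NormedSpace.exp a - Complex.exp p • 1) * (NormedSpace.exp a - Complex.exp q • 1))
        = 0 := by
      rw [← smul_mul_smul_comm, e1, e2, smul_mul_smul_comm, h, smul_zero]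
    exact (smul_eq_zero.1 this).resolve_left (mul_ne_zero d0 d0)

lemma unique_ne {x a b : Matrix (Fin 2) (Fin 2) ℂ} (ha : IsPrincipalLog x a)
    (hb : IsPrincipalLog x b) {p q : ℂ} (hp : p ∈ spectrum ℂ a) (hq : q ∈ spectrum ℂ a)
    (h : (a - p • 1) * (a - q • 1) = 0) (hpq : p ≠ q) : a = b := by
  have hpq' : Complex.exp p ≠ Complex.exp q :=
    fun e => hpq (strip_inj (ha.2 p hp) (ha.2 q hq) e)
  obtain ⟨r, hr, s, hs, h'⟩ := spec_pair b
  have hx := exp_poly h'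
  rw [hb.1] at hx
  have hp1 := exp_spec hp
  have hq1 := exp_spec hq
  rw [ha.1] at hp1 hq1
  have e1 := exp_of_mul_eq_zero h
  have e2 : (p - q) • NormedSpace.exp b =
      Complex.exp p • (b - q • 1) - Complex.exp q • (b - p • 1) := by
    rcases spec_sub hx hp1 with e | e <;> rcases spec_sub hx hq1 with f | f
    · exact absurd (e.trans f.symm) hpq'
    · obtain rfl := strip_inj (ha.2 p hp) (hb.2 _ hr) e
      obtain rfl := strip_inj (ha.2 q hq) (hb.2 _ hs) f
      exact exp_of_mul_eq_zero h'
    · obtain rfl := strip_inj (ha.2 p hp) (hb.2 _ hs) e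
      obtain rfl := strip_inj (ha.2 q hq) (hb.2 _ hr) f
      have := exp_of_mul_eq_zero h'
      rw [← neg_sub, neg_smul, this]
      abel
    · exact absurd (e.trans f.symm) hpq'
  rw [ha.1] at e1
  rw [hb.1, e1] at e2
  have : (Complex.exp p - Complex.exp q) • (a - b) = 0 := by
    rw [← sub_eq_zero] at e2
    rw [← e2]
    module
  exact sub_eq_zero.1 ((smul_eq_zero.1 this).resolve_left (sub_ne_zero.2 hpq'))

/-- A 2×2 matrix has at most one principal logarithm. -/
theorem isPrincipalLog_unique {x a b : Matrix (Fin 2) (Fin 2) ℂ} (ha : IsPrincipalLog x a)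
    (hb : IsPrincipalLog x b) : a = b := by
  obtain ⟨p, hp, q, hq, h⟩ := spec_pair a
  obtain ⟨r, hr, s, hs, h'⟩ := spec_pair b
  by_cases hpq : p = q
  · by_cases hrs : r = s
    · subst hpq hrs
      have hx := exp_poly h'
      rw [hb.1] at hx
      have hp1 := exp_spec hp
      rw [ha.1] at hp1
      have e : Complex.exp p = Complex.exp r := (spec_sub hx hp1).elim id id
      obtain rfl := strip_inj (ha.2 p hp) (hb.2 _ hr) e
      have e1 := exp_of_sq_eq_zero h
      rw [ha.1, ← hb.1, exp_of_sq_eq_zero h'] at e1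
      have := smul_right_injective _ (Complex.exp_ne_zero p) e1
      simpa using this.symm
    · exact (unique_ne hb ha hr hs h' hrs).symm
  · exact unique_ne ha hb hp hq h hpq

/-- `matrixLog x` is the principal logarithm of a 2×2 matrix `x` without eigenvalues
in `]-∞, 0]`. -/
theorem matrixLog_spec {x : Matrix (Fin 2) (Fin 2) ℂ} (hx : NoNonposEigenvalue x) :
    IsPrincipalLog x (matrixLog x) := by
  have h := exists_isPrincipalLog hx
  rw [matrixLog, dif_pos h]
  exact h.choose_spec

end MatrixLog

/-
On `2 × 2` matrices the exponential is affine: `exp a` is a combination of `1` and `a` whose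
coefficient at `a` is the divided difference of `exp` at the two eigenvalues of `a`. If `a` and `b`
do not commute, then `exp a * exp b = exp (a + b)` forces `(a - m) * (b - l) = 0` for suitable
scalars `m` and `l`. The eigenvalues of `a`, `b` and `a + b` are then `m, m + t`, `l, l + s` and
`m + l + t, m + l + s`, and comparing coefficients shows that the divided differences of `exp` at
`(0, t)`, `(0, s)` and `(t, s)` agree. The eigenvalues being in the strip `|Im z| < π`, the
imaginary parts of `0`, `t` and `s` differ by less than `2π`, and injectivity of `(exp z - 1) / z`
on `0 ≤ Im z < 2π` gives `t = s = 0`. Hence `a - m`, `b - l` and their sum all square to zero, and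
together with `(a - m) * (b - l) = 0` this makes `a` and `b` commute.
-/
namespace MatrixLog

open Complex ComplexConjugate

/- Noshiro–Warschawski: by Rolle's theorem for `Im (f / (b - a))` along the segment from `a` to
`b`, the equality `f a = f b` forces `Im f'` to vanish somewhere on it. -/
lemma injOn_of_im_deriv_ne_zero {f f' : ℂ → ℂ} {s : Set ℂ} (hs : Convex ℝ s)
    (hf : ∀ z ∈ s, HasDerivAt f (f' z) z) (hf' : ∀ z ∈ s, (f' z).im ≠ 0) : Set.InjOn f s := by
  intro a ha b hb hab
  by_contra hne
  have hd : b - a ≠ 0 := sub_ne_zero.2 (Ne.symm hne)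
  have hmem : ∀ t ∈ Set.Icc (0 : ℝ) 1, a + t * (b - a) ∈ s := fun t ht => by
    simpa using hs.add_smul_sub_mem ha hb ht
  have hderiv : ∀ t ∈ Set.Icc (0 : ℝ) 1, HasDerivAt
      (fun t : ℝ => (f (a + t * (b - a)) / (b - a)).im) (f' (a + t * (b - a))).im t := by
    intro t ht
    have hline : HasDerivAt (fun z : ℂ => a + z * (b - a)) (b - a) (t : ℂ) := by
      simpa using ((hasDerivAt_id (t : ℂ)).mul_const (b - a)).const_add a
    have hcomp := (((hf _ (hmem t ht)).comp (t : ℂ) hline).div_const (b - a)).comp_ofReal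
    rw [mul_div_cancel_right₀ _ hd] at hcomp
    exact imCLM.hasFDerivAt.comp_hasDerivAt t hcomp
  obtain ⟨t, ht, hzero⟩ := exists_hasDerivAt_eq_zero one_pos
    (fun t ht => (hderiv t ht).continuousAt.continuousWithinAt) (by simp [hab])
    fun t ht => hderiv t (Set.Ioo_subset_Icc_self ht)
  exact hf' _ (hmem t (Set.Ioo_subset_Icc_self ht)) hzero

lemma mul_cos_lt_sin {y : ℝ} (h₀ : 0 < y) (hπ : y < Real.pi) :
    y * Real.cos y < Real.sin y := by
  rcases lt_or_ge y (Real.pi / 2) with hy | hy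
  · have hcos : 0 < Real.cos y := Real.cos_pos_of_mem_Ioo ⟨by linarith, hy⟩
    rw [← lt_div_iff₀ hcos, ← Real.tan_eq_sin_div_cos]
    exact Real.lt_tan h₀ hy
  · have hcos : Real.cos y ≤ 0 := Real.cos_nonpos_of_pi_div_two_le_of_le hy (by linarith)
    exact (mul_nonpos_of_nonneg_of_nonpos h₀.le hcos).trans_lt (Real.sin_pos_of_pos_of_lt_pi h₀ hπ)

lemma mul_sin_lt_two_mul_one_sub_cos {y : ℝ} (h₀ : 0 < y) (h₂π : y < 2 * Real.pi) :
    y * Real.sin y < 2 * (1 - Real.cos y) := by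
  obtain ⟨h, rfl⟩ : ∃ h, y = 2 * h := ⟨y / 2, by ring⟩
  have hsin : 0 < Real.sin h := Real.sin_pos_of_pos_of_lt_pi (by linarith) (by linarith)
  have hlt : h * Real.cos h < Real.sin h := mul_cos_lt_sin (by linarith) (by linarith)
  rw [Real.sin_two_mul, Real.cos_two_mul']
  nlinarith [Real.sin_sq_add_cos_sq h, mul_lt_mul_of_pos_left hlt hsin]

lemma sq_mul_exp_le_sq_exp_sub_one (x : ℝ) :
    x ^ 2 * Real.exp x ≤ (Real.exp x - 1) ^ 2 := by
  have hsinh : (x / 2) ^ 2 ≤ Real.sinh (x / 2) ^ 2 := by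
    rw [sq_le_sq, Real.abs_sinh]
    exact Real.self_le_sinh_iff.2 (abs_nonneg _)
  have hexp : Real.exp x = Real.exp (x / 2) ^ 2 := by rw [← Real.exp_nat_mul]; congr 1; ring
  have hsub : Real.exp x - 1 = 2 * Real.exp (x / 2) * Real.sinh (x / 2) := by
    rw [Real.sinh_eq, Real.exp_neg, hexp]
    field_simp
  rw [hsub, hexp]
  nlinarith [mul_le_mul_of_nonneg_left hsinh (sq_nonneg (2 * Real.exp (x / 2)))]

lemma exp_ne_one_add_ofReal_mul {z : ℂ} (h₀ : 0 < z.im) (h₂π : z.im < 2 * Real.pi) {r : ℝ}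
    (hr : 0 ≤ r) : exp z ≠ 1 + r * z := by
  intro h
  obtain ⟨hre, him⟩ := Complex.ext_iff.1 h
  simp only [exp_re, exp_im, add_re, add_im, one_re, one_im, re_ofReal_mul, im_ofReal_mul,
    zero_add] at hre him
  have hexp := Real.exp_pos z.re
  rcases lt_or_ge z.im Real.pi with hy | hy
  · have hsin := Real.sin_pos_of_pos_of_lt_pi h₀ hy
    have hcos := mul_cos_lt_sin h₀ hy
    have hle : Real.exp z.re * (1 - z.re) ≤ 1 := by
      calc Real.exp z.re * (1 - z.re) ≤ Real.exp z.re * Real.exp (-z.re) := by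
            gcongr; linarith [Real.add_one_le_exp (-z.re)]
        _ = 1 := by rw [← Real.exp_add, add_neg_cancel, Real.exp_zero]
    have hlt : z.im < Real.sin z.im := calc
      z.im = Real.exp z.re * (z.im * Real.cos z.im - z.re * Real.sin z.im) := by
        linear_combination z.re * him - z.im * hre
      _ < Real.exp z.re * (Real.sin z.im - z.re * Real.sin z.im) := by gcongr
      _ = Real.exp z.re * (1 - z.re) * Real.sin z.im := by ring
      _ ≤ 1 * Real.sin z.im := by gcongr
      _ = Real.sin z.im := one_mul _
    exact hlt.not_gt (Real.sin_lt h₀)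
  · have hsin : Real.sin z.im ≤ 0 := by
      rw [← Real.sin_sub_two_pi]
      exact Real.sin_nonpos_of_nonpos_of_neg_pi_le (by linarith) (by linarith)
    have hmul : r * z.im = 0 := le_antisymm
      (him ▸ mul_nonpos_of_nonneg_of_nonpos hexp.le hsin) (mul_nonneg hr h₀.le)
    have hr₀ : r = 0 := (mul_eq_zero.1 hmul).resolve_right h₀.ne'
    have hsin₀ : Real.sin z.im = 0 := (mul_eq_zero.1 (him.trans hmul)).resolve_left hexp.ne'
    rw [hr₀, zero_mul, add_zero] at hre
    have hcos : 0 < Real.cos z.im := pos_of_mul_pos_right (hre ▸ one_pos) hexp.le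
    have hcos' := mul_sin_lt_two_mul_one_sub_cos h₀ h₂π
    rw [hsin₀] at hcos'
    nlinarith [Real.sin_sq_add_cos_sq z.im]

lemma exp_sub_one_ne_zero {z : ℂ} (h₀ : 0 < z.im) (h₂π : z.im < 2 * Real.pi) :
    exp z - 1 ≠ 0 :=
  fun h => exp_ne_one_add_ofReal_mul h₀ h₂π le_rfl (by simpa [sub_eq_zero] using h)

lemma dslope_exp_zero_of_ne {z : ℂ} (hz : z ≠ 0) : dslope exp 0 z = (exp z - 1) / z := by
  rw [dslope_of_ne exp hz, slope_def_field, exp_zero, sub_zero]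

lemma neg_dslope_exp_zero_mem_slitPlane {z : ℂ} (h₀ : 0 < z.im) (h₂π : z.im < 2 * Real.pi) :
    -dslope exp 0 z ∈ slitPlane := by
  have hz : z ≠ 0 := fun h => h₀.ne' (by simp [h])
  by_contra hslit
  rw [mem_slitPlane_iff, neg_re, neg_im] at hslit
  push Not at hslit
  have hreal : dslope exp 0 z = (dslope exp 0 z).re :=
    Complex.ext rfl (neg_eq_zero.1 hslit.2)
  refine exp_ne_one_add_ofReal_mul h₀ h₂π (neg_nonpos.1 hslit.1) ?_
  rw [← hreal, dslope_exp_zero_of_ne hz]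
  field_simp
  ring

/- The left-hand side is the derivative of `log ((1 - exp z) / z)`. -/
lemma im_exp_div_exp_sub_one_sub_inv_pos {z : ℂ} (h₀ : 0 < z.im) (h₂π : z.im < 2 * Real.pi) :
    0 < (exp z / (exp z - 1) - z⁻¹).im := by
  have hz : z ≠ 0 := fun h => h₀.ne' (by simp [h])
  have hnorm : normSq (exp z - 1) =
      (Real.exp z.re - 1) ^ 2 + 2 * Real.exp z.re * (1 - Real.cos z.im) := by
    rw [normSq_apply, sub_re, sub_im, one_re, one_im, exp_re, exp_im]
    linear_combination Real.exp z.re ^ 2 * Real.sin_sq_add_cos_sq z.im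
  have hlt : Real.exp z.re * Real.sin z.im * normSq z < z.im * normSq (exp z - 1) := calc
    _ = Real.exp z.re * (z.re ^ 2 * Real.sin z.im + z.im * (z.im * Real.sin z.im)) := by
      rw [normSq_apply]; ring
    _ < Real.exp z.re * (z.re ^ 2 * z.im + z.im * (2 * (1 - Real.cos z.im))) := by
      have hsin := mul_le_mul_of_nonneg_left (Real.sin_le h₀.le) (sq_nonneg z.re)
      have hcos := mul_lt_mul_of_pos_left (mul_sin_lt_two_mul_one_sub_cos h₀ h₂π) h₀
      exact mul_lt_mul_of_pos_left (add_lt_add_of_le_of_lt hsin hcos) (Real.exp_pos z.re)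
    _ = z.im * (z.re ^ 2 * Real.exp z.re + 2 * Real.exp z.re * (1 - Real.cos z.im)) := by ring
    _ ≤ z.im * normSq (exp z - 1) := by
      rw [hnorm]
      gcongr
      exact sq_mul_exp_le_sq_exp_sub_one z.re
  have hexp : 0 < normSq (exp z - 1) := normSq_pos.2 (exp_sub_one_ne_zero h₀ h₂π)
  have himdiv : (exp z / (exp z - 1)).im =
      -(Real.exp z.re * Real.sin z.im / normSq (exp z - 1)) := by
    rw [div_im, sub_re, sub_im, one_re, one_im, exp_im]
    ring
  rw [sub_im, himdiv, inv_im, neg_div, sub_neg_eq_add, neg_add_eq_sub, sub_pos,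
    div_lt_div_iff₀ hexp (normSq_pos.2 hz)]
  exact hlt

lemma injOn_dslope_exp_zero_openStrip :
    Set.InjOn (dslope exp 0) {z | 0 < z.im ∧ z.im < 2 * Real.pi} := by
  have hconv : Convex ℝ {z : ℂ | 0 < z.im ∧ z.im < 2 * Real.pi} :=
    (convex_halfSpace_im_gt 0).inter (convex_halfSpace_im_lt _)
  refine Set.InjOn.of_comp (g := fun w : ℂ => log (-w)) (injOn_of_im_deriv_ne_zero hconv
    (f' := fun z => exp z / (exp z - 1) - z⁻¹) ?_
    fun z hz => (im_exp_div_exp_sub_one_sub_inv_pos hz.1 hz.2).ne')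
  rintro z ⟨h₀, h₂π⟩
  have hz : z ≠ 0 := fun h => h₀.ne' (by simp [h])
  have hslit := neg_dslope_exp_zero_mem_slitPlane h₀ h₂π
  have hexp := exp_sub_one_ne_zero h₀ h₂π
  have heq : dslope exp 0 =ᶠ[nhds z] fun w => (exp w - 1) / w := by
    filter_upwards [isOpen_ne.mem_nhds hz] with w hw using dslope_exp_zero_of_ne hw
  have hderiv : HasDerivAt (dslope exp 0) ((exp z * z - (exp z - 1) * 1) / z ^ 2) z :=
    (((hasDerivAt_exp z).sub_const 1).div (hasDerivAt_id z) hz).congr_of_eventuallyEq heq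
  refine (hderiv.neg.clog hslit).congr_deriv ?_
  rw [Pi.neg_apply, dslope_exp_zero_of_ne hz]
  field_simp

lemma strictMonoOn_dslope {f : ℝ → ℝ} {s : Set ℝ} {a : ℝ} (hf : StrictConvexOn ℝ s f)
    (ha : a ∈ s) (hfa : DifferentiableAt ℝ f a) : StrictMonoOn (dslope f a) s := by
  intro x hx y hy hxy
  rcases eq_or_ne x a with rfl | hxa
  · rw [dslope_same, dslope_of_ne _ hxy.ne']
    exact hf.deriv_lt_slope hx hy hxy hfa
  rcases eq_or_ne y a with rfl | hya
  · rw [dslope_same, dslope_of_ne _ hxy.ne, slope_comm]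
    exact hf.slope_lt_deriv hx hy hxy hfa
  · rw [dslope_of_ne _ hxa, dslope_of_ne _ hya, slope_def_field, slope_def_field]
    exact hf.secant_strict_mono ha hx hy hxa hya hxy

lemma dslope_real_exp_zero_pos (x : ℝ) : 0 < dslope Real.exp 0 x := by
  rcases eq_or_ne x 0 with rfl | hx
  · simp
  · rw [dslope_of_ne _ hx]
    exact (Real.exp_strictMono.strictMonoOn Set.univ).slope_pos trivial trivial hx.symm

lemma dslope_exp_zero_ofReal (x : ℝ) : dslope exp 0 (x : ℂ) = (dslope Real.exp 0 x : ℝ) := by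
  rcases eq_or_ne x 0 with rfl | hx
  · simp
  · rw [dslope_of_ne _ hx, dslope_of_ne _ (ofReal_ne_zero.2 hx), slope_def_field, slope_def_field]
    simp

lemma injOn_dslope_exp_zero_halfOpenStrip :
    Set.InjOn (dslope exp 0) {z | 0 ≤ z.im ∧ z.im < 2 * Real.pi} := by
  have hreal : ∀ {z : ℂ}, 0 = z.im → z = z.re := fun h => Complex.ext rfl h.symm
  have hne : ∀ {x : ℝ} {z : ℂ}, 0 < z.im → z.im < 2 * Real.pi →
      dslope exp 0 x ≠ dslope exp 0 z := by
    intro x z h₀ h₂π h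
    have hslit := neg_dslope_exp_zero_mem_slitPlane h₀ h₂π
    rw [← h, dslope_exp_zero_ofReal, ← ofReal_neg, ofReal_mem_slitPlane] at hslit
    linarith [dslope_real_exp_zero_pos x]
  rintro z ⟨hz, hz'⟩ w ⟨hw, hw'⟩ h
  rcases hz.eq_or_lt with hz | hz <;> rcases hw.eq_or_lt with hw | hw
  · rw [hreal hz, hreal hw, dslope_exp_zero_ofReal, dslope_exp_zero_ofReal, ofReal_inj] at h
    rw [hreal hz, hreal hw, (strictMonoOn_dslope strictConvexOn_exp trivial
      Real.differentiableAt_exp).injOn trivial trivial h]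
  · rw [hreal hz] at h
    exact absurd h (hne hw hw')
  · rw [hreal hw] at h
    exact absurd h.symm (hne hz hz')
  · exact injOn_dslope_exp_zero_openStrip ⟨hz, hz'⟩ ⟨hw, hw'⟩ h

lemma dslope_exp_add_left (c a b : ℂ) :
    dslope exp (c + a) (c + b) = exp c * dslope exp a b := by
  rcases eq_or_ne b a with rfl | h
  · simp [exp_add]
  · rw [dslope_of_ne _ h, dslope_of_ne _ (add_right_injective c |>.ne h), slope_def_field,
      slope_def_field, add_sub_add_left_eq_sub, exp_add, exp_add, ← mul_sub, mul_div_assoc]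

lemma dslope_comm {𝕜 E : Type*} [NontriviallyNormedField 𝕜] [NormedAddCommGroup E]
    [NormedSpace 𝕜 E] (f : 𝕜 → E) (a b : 𝕜) : dslope f a b = dslope f b a := by
  rcases eq_or_ne a b with rfl | h
  · rfl
  · rw [dslope_of_ne f h, dslope_of_ne f h.symm, slope_comm]

lemma dslope_exp_conj (a b : ℂ) : dslope exp (conj a) (conj b) = conj (dslope exp a b) := by
  rcases eq_or_ne b a with rfl | h
  · simp [exp_conj]
  · rw [dslope_of_ne _ h, dslope_of_ne _ ((starRingEnd ℂ).injective.ne h), slope_def_field,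
      slope_def_field]
    simp [exp_conj]

lemma injOn_dslope_exp_above (a : ℂ) :
    Set.InjOn (dslope exp a) {z | a.im ≤ z.im ∧ z.im < a.im + 2 * Real.pi} := by
  rintro z ⟨hz, hz'⟩ w ⟨hw, hw'⟩ h
  have hbase : ∀ u, dslope exp a u = exp a * dslope exp 0 (u - a) := fun u => by
    simpa only [add_zero, add_sub_cancel] using dslope_exp_add_left a 0 (u - a)
  rw [hbase, hbase, mul_right_inj' (exp_ne_zero a)] at h
  refine sub_left_injective (injOn_dslope_exp_zero_halfOpenStrip ⟨?_, ?_⟩ ⟨?_, ?_⟩ h) <;>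
    rw [sub_im] <;> linarith

lemma injOn_dslope_exp_below (a : ℂ) :
    Set.InjOn (dslope exp a) {z | z.im ≤ a.im ∧ a.im < z.im + 2 * Real.pi} := by
  have hconj : ∀ {z : ℂ}, z.im ≤ a.im ∧ a.im < z.im + 2 * Real.pi →
      (conj a).im ≤ (conj z).im ∧ (conj z).im < (conj a).im + 2 * Real.pi := by
    rintro z ⟨hz, hz'⟩
    constructor <;> rw [conj_im, conj_im] <;> linarith
  intro z hz w hw h
  refine (starRingEnd ℂ).injective (injOn_dslope_exp_above (conj a) (hconj hz) (hconj hw) ?_)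
  rw [dslope_exp_conj, dslope_exp_conj, h]

lemma eq_of_dslope_exp_eq_of_le {a b c : ℂ} (hab : a.im ≤ b.im) (hab' : b.im < a.im + 2 * Real.pi)
    (hac : a.im ≤ c.im) (hac' : c.im < a.im + 2 * Real.pi)
    (h₁ : dslope exp a b = dslope exp a c) (h₂ : dslope exp a c = dslope exp b c) :
    a = b ∧ b = c := by
  obtain rfl : b = c := injOn_dslope_exp_above a ⟨hab, hab'⟩ ⟨hac, hac'⟩ h₁
  rw [dslope_comm] at h₂
  exact ⟨injOn_dslope_exp_below b ⟨hab, hab'⟩ ⟨le_rfl, by linarith [Real.pi_pos]⟩ h₂, rfl⟩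

/- Equality of the three divided differences says that three points of the graph of `exp`, counted
with multiplicity, lie on a complex line. -/
lemma eq_of_dslope_exp_eq {a b c : ℂ} (hab : |(a - b).im| < 2 * Real.pi)
    (hac : |(a - c).im| < 2 * Real.pi) (hbc : |(b - c).im| < 2 * Real.pi)
    (h₁ : dslope exp a b = dslope exp a c) (h₂ : dslope exp a c = dslope exp b c) :
    a = b ∧ b = c := by
  rw [sub_im, abs_lt] at hab hac hbc
  by_cases ha : a.im ≤ b.im ∧ a.im ≤ c.im
  · exact eq_of_dslope_exp_eq_of_le ha.1 (by linarith) ha.2 (by linarith) h₁ h₂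
  by_cases hb : b.im ≤ a.im ∧ b.im ≤ c.im
  · obtain ⟨hba, hac⟩ := eq_of_dslope_exp_eq_of_le hb.1 (by linarith) hb.2 (by linarith)
      ((dslope_comm exp b a).trans (h₁.trans h₂)) h₂.symm
    exact ⟨hba.symm, hba.trans hac⟩
  have hc : c.im ≤ a.im ∧ c.im ≤ b.im := by grind
  obtain ⟨hca, hab⟩ := eq_of_dslope_exp_eq_of_le hc.1 (by linarith) hc.2 (by linarith)
    (by rw [dslope_comm exp c a, dslope_comm exp c b, h₂])
    (by rw [dslope_comm exp c b, ← h₂, h₁])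
  exact ⟨hab, hab.symm.trans hca.symm⟩

lemma dslope_exp_ne_zero {a b : ℂ} (ha : a.im ∈ Set.Ioo (-Real.pi) Real.pi)
    (hb : b.im ∈ Set.Ioo (-Real.pi) Real.pi) : dslope exp a b ≠ 0 := by
  rcases eq_or_ne b a with rfl | hab
  · simp
  · rw [dslope_of_ne _ hab, slope_def_field]
    exact div_ne_zero (sub_ne_zero.2 fun h => hab (exp_inj_of_neg_pi_lt_of_le_pi
      hb.1 hb.2.le ha.1 ha.2.le h)) (sub_ne_zero.2 hab)

lemma abs_im_sub_lt {p q : ℂ} (hp : p.im ∈ Set.Ioo (-Real.pi) Real.pi)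
    (hq : q.im ∈ Set.Ioo (-Real.pi) Real.pi) : |(p - q).im| < 2 * Real.pi := by
  rw [sub_im, abs_lt]
  constructor <;> linarith [hp.1, hp.2, hq.1, hq.2]

section Algebra

variable {K A : Type*} [Field K] [Ring A] [Algebra K A] {a b : A}

lemma eq_and_eq_of_smul_one_add_smul_eq {p q p' q' : K} (hab : ¬Commute a b)
    (h : p • 1 + q • a = p' • 1 + q' • a) : p = p' ∧ q = q' := by
  have hne : (1 : A) ≠ 0 := fun h₀ => hab (by
    rw [← one_mul a, h₀, zero_mul]; exact Commute.zero_left b)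
  have hq : q = q' := by
    by_contra hne'
    refine hab ?_
    have ha : a = ((q - q')⁻¹ * (p' - p)) • 1 := by
      rw [mul_smul, eq_inv_smul_iff₀ (sub_ne_zero.2 hne'), sub_smul, sub_smul]
      linear_combination (norm := module) h
    rw [ha]
    exact (Commute.one_left b).smul_left _
  subst hq
  exact ⟨smul_left_injective K hne (add_right_cancel h), rfl⟩

lemma commute_sub_smul_one_iff (m l : K) : Commute (a - m • 1) (b - l • 1) ↔ Commute a b := by
  simp only [commute_iff_eq, sub_mul, mul_sub, smul_mul_assoc, mul_smul_comm, one_mul, mul_one]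
  constructor <;> intro h <;> linear_combination (norm := module) h

lemma commute_of_mul_eq_smul_one [IsDedekindFiniteMonoid A] {c : K} (hc : c ≠ 0)
    (h : a * b = c • 1) : Commute a b := by
  have hleft : (c⁻¹ • a) * b = 1 := by
    rw [smul_mul_assoc, h, smul_smul, inv_mul_cancel₀ hc, one_smul]
  have hright : b * (c⁻¹ • a) = 1 := mul_eq_one_symm hleft
  rw [mul_smul_comm, inv_smul_eq_iff₀ hc] at hright
  exact h.trans hright.symm

lemma exists_sub_mul_sub_eq_zero [IsDedekindFiniteMonoid A] {p₁ q₁ p₂ q₂ p₃ q₃ : K}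
    (hab : ¬Commute a b) (hq₁ : q₁ ≠ 0) (hq₂ : q₂ ≠ 0)
    (h : (p₁ • 1 + q₁ • a) * (p₂ • 1 + q₂ • b) = p₃ • 1 + q₃ • (a + b)) :
    ∃ m l : K, (a - m • 1) * (b - l • 1) = 0 ∧
      q₂ * (p₁ + q₁ * m) = q₃ ∧ q₁ * (p₂ + q₂ * l) = q₃ := by
  -- With these `m` and `l` the terms linear in `a` and `b` cancel, so `(a - m) * (b - l)` is a
  -- scalar; a nonzero one would make `a - m` and `b - l` inverse to each other up to scaling.
  obtain ⟨m, hm⟩ : ∃ m, q₂ * (p₁ + q₁ * m) = q₃ := ⟨(q₃ / q₂ - p₁) / q₁, by field_simp; ring⟩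
  obtain ⟨l, hl⟩ : ∃ l, q₁ * (p₂ + q₂ * l) = q₃ := ⟨(q₃ / q₁ - p₂) / q₂, by field_simp; ring⟩
  refine ⟨m, l, ?_, hm, hl⟩
  obtain ⟨c, hc⟩ : ∃ c : K, (a - m • 1) * (b - l • 1) = c • 1 := by
    refine ⟨(q₁ * q₂)⁻¹ * (p₃ - p₁ * p₂ + q₁ * q₂ * m * l), ?_⟩
    rw [mul_smul, eq_inv_smul_iff₀ (mul_ne_zero hq₁ hq₂)]
    simp only [add_mul, mul_add, sub_mul, mul_sub, smul_mul_assoc, mul_smul_comm, one_mul,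
      mul_one] at h ⊢
    linear_combination (norm := module) h - hm • b - hl • a
  have hc₀ : c = 0 := by
    by_contra hne
    exact hab ((commute_sub_smul_one_iff m l).1 (commute_of_mul_eq_smul_one hne hc))
  rw [hc, hc₀, zero_smul]

end Algebra

section Eigenvalues

/-- `p` and `q` are the eigenvalues of the 2×2 matrix `a`, counted with multiplicity; this is
encoded through the trace and the determinant. -/
def HasEigenvalues {R : Type*} [CommRing R] (a : Matrix (Fin 2) (Fin 2) R) (p q : R) : Prop :=
  a.trace = p + q ∧ a.det = p * q

section CommRing

variable {R : Type*} [CommRing R] {a b : Matrix (Fin 2) (Fin 2) R} {p q : R}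

lemma HasEigenvalues.symm (h : HasEigenvalues a p q) : HasEigenvalues a q p :=
  ⟨h.1.trans (add_comm p q), h.2.trans (mul_comm p q)⟩

lemma HasEigenvalues.add_smul_one (h : HasEigenvalues a p q) (m : R) :
    HasEigenvalues (a + m • 1) (m + p) (m + q) := by
  obtain ⟨htr, hdet⟩ := h
  rw [Matrix.trace_fin_two] at htr
  rw [Matrix.det_fin_two] at hdet
  constructor
  · simp only [Matrix.trace_add, Matrix.trace_fin_two, Matrix.trace_smul, Matrix.trace_one,
      Fintype.card_fin, Nat.cast_ofNat, smul_eq_mul]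
    linear_combination htr
  · simp only [Matrix.det_fin_two, Matrix.add_apply, Matrix.smul_apply, Matrix.one_apply_eq,
      Matrix.one_apply_ne zero_ne_one, Matrix.one_apply_ne one_ne_zero, smul_eq_mul, mul_one,
      mul_zero, add_zero]
    linear_combination hdet + m * htr

lemma HasEigenvalues.sub_mul_sub (h : HasEigenvalues a p q) : (a - p • 1) * (a - q • 1) = 0 := by
  nontriviality R
  have hch := a.aeval_self_charpoly
  rw [Matrix.charpoly_fin_two, h.1, h.2] at hch
  simp only [map_add, map_sub, map_mul, map_pow, Polynomial.aeval_X, Polynomial.aeval_C,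
    Algebra.algebraMap_eq_smul_one, add_mul, smul_mul_assoc, mul_smul_comm, one_mul,
    mul_one] at hch
  rw [← hch]
  simp only [sub_mul, mul_sub, smul_mul_assoc, mul_smul_comm, one_mul, mul_one, sq]
  module

lemma det_add_fin_two (a b : Matrix (Fin 2) (Fin 2) R) :
    (a + b).det = a.det + b.det + a.trace * b.trace - (a * b).trace := by
  simp only [Matrix.det_fin_two, Matrix.trace_fin_two, Matrix.mul_apply, Fin.sum_univ_two,
    Matrix.add_apply]
  ring

lemma HasEigenvalues.add_of_mul_eq_zero {s t : R} (ha : HasEigenvalues a 0 t)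
    (hb : HasEigenvalues b 0 s) (hab : a * b = 0) : HasEigenvalues (a + b) t s := by
  refine ⟨?_, ?_⟩
  · rw [Matrix.trace_add, ha.1, hb.1]; ring
  · rw [det_add_fin_two, ha.1, ha.2, hb.1, hb.2, hab, Matrix.trace_zero]; ring

lemma commute_of_hasEigenvalues_self {m l : R} (ha : HasEigenvalues a m m)
    (hb : HasEigenvalues b l l) (hab : HasEigenvalues (a + b) (m + l) (m + l))
    (h : (a - m • 1) * (b - l • 1) = 0) : Commute a b := by
  have ha' := ha.sub_mul_sub
  have hb' := hb.sub_mul_sub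
  have hab' := hab.sub_mul_sub
  simp only [sub_mul, mul_sub, add_mul, mul_add, smul_mul_assoc, mul_smul_comm, one_mul, mul_one]
    at h ha' hb' hab'
  rw [commute_iff_eq]
  linear_combination (norm := module) ha' + hb' + 2 • h - hab'

end CommRing

section Field

variable {K : Type*} [Field K] {p q : K}

lemma HasEigenvalues.left_mem_spectrum {a : Matrix (Fin 2) (Fin 2) K} (h : HasEigenvalues a p q) :
    p ∈ spectrum K a := by
  rw [Matrix.mem_spectrum_iff_isRoot_charpoly, Matrix.charpoly_fin_two, h.1, h.2]
  simp only [Polynomial.IsRoot.def, Polynomial.eval_add, Polynomial.eval_sub, Polynomial.eval_pow,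
    Polynomial.eval_X, Polynomial.eval_mul, Polynomial.eval_C]
  ring

lemma HasEigenvalues.right_mem_spectrum {a : Matrix (Fin 2) (Fin 2) K}
    (h : HasEigenvalues a p q) : q ∈ spectrum K a :=
  h.symm.left_mem_spectrum

lemma exists_hasEigenvalues [IsAlgClosed K] (a : Matrix (Fin 2) (Fin 2) K) :
    ∃ p q, HasEigenvalues a p q := by
  obtain ⟨p, hp⟩ := spectrum.nonempty_of_isAlgClosed_of_finiteDimensional K a
  rw [Matrix.mem_spectrum_iff_isRoot_charpoly, Matrix.charpoly_fin_two] at hp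
  simp only [Polynomial.IsRoot.def, Polynomial.eval_add, Polynomial.eval_sub, Polynomial.eval_pow,
    Polynomial.eval_X, Polynomial.eval_mul, Polynomial.eval_C] at hp
  exact ⟨p, a.trace - p, (add_sub_cancel p _).symm, by linear_combination hp⟩

lemma det_eq_zero_of_mul_eq_zero {n : Type*} [Fintype n] [DecidableEq n] {a b : Matrix n n K}
    (h : a * b = 0) (hab : ¬Commute a b) : a.det = 0 ∧ b.det = 0 := by
  constructor <;> by_contra hdet <;> refine hab ?_
  · have hb : b = 0 := by
      simpa [h] using (Matrix.nonsing_inv_mul_cancel_left a b (isUnit_iff_ne_zero.2 hdet)).symm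
    rw [hb]; exact Commute.zero_right a
  · have ha : a = 0 := by
      simpa [h] using (Matrix.mul_nonsing_inv_cancel_right b a (isUnit_iff_ne_zero.2 hdet)).symm
    rw [ha]; exact Commute.zero_left b

lemma exists_hasEigenvalues_of_sub_mul_sub_eq_zero {a b : Matrix (Fin 2) (Fin 2) K} {m l : K}
    (h : (a - m • 1) * (b - l • 1) = 0) (hab : ¬Commute a b) :
    ∃ t s, HasEigenvalues a m (m + t) ∧ HasEigenvalues b l (l + s) ∧
      HasEigenvalues (a + b) (m + l + t) (m + l + s) := by
  obtain ⟨ha, hb⟩ := det_eq_zero_of_mul_eq_zero h (mt (commute_sub_smul_one_iff m l).1 hab)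
  have ha₀ : HasEigenvalues (a - m • 1) 0 (a - m • 1).trace := by simp [HasEigenvalues, ha]
  have hb₀ : HasEigenvalues (b - l • 1) 0 (b - l • 1).trace := by simp [HasEigenvalues, hb]
  refine ⟨(a - m • 1).trace, (b - l • 1).trace, ?_, ?_, ?_⟩
  · simpa using ha₀.add_smul_one m
  · simpa using hb₀.add_smul_one l
  · convert (ha₀.add_of_mul_eq_zero hb₀ h).add_smul_one (m + l) using 1
    module

end Field

lemma HasEigenvalues.exp_eq {a : Matrix (Fin 2) (Fin 2) ℂ} {p q : ℂ} (h : HasEigenvalues a p q) :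
    NormedSpace.exp a = (exp p - dslope exp p q * p) • 1 + dslope exp p q • a := by
  rcases eq_or_ne q p with rfl | hqp
  · rw [exp_of_sq_eq_zero h.sub_mul_sub, dslope_same, Complex.deriv_exp]
    module
  · have hsub : exp q - exp p = dslope exp p q * (q - p) := by
      rw [← sub_smul_dslope, smul_eq_mul, mul_comm]
    have hinj := smul_right_injective (Matrix (Fin 2) (Fin 2) ℂ) (sub_ne_zero.2 hqp.symm)
    refine hinj ?_
    dsimp only
    rw [exp_of_mul_eq_zero h.sub_mul_sub, eq_add_of_sub_eq hsub]
    module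

lemma HasEigenvalues.exp_coeff_eq {a b : Matrix (Fin 2) (Fin 2) ℂ} {p q r s : ℂ}
    (h : HasEigenvalues a p q) (hab : ¬Commute a b)
    (hexp : NormedSpace.exp a = r • 1 + s • a) : r + s * p = exp p ∧ s = dslope exp p q := by
  obtain ⟨rfl, rfl⟩ := eq_and_eq_of_smul_one_add_smul_eq hab (hexp.symm.trans h.exp_eq)
  exact ⟨sub_add_cancel _ _, rfl⟩

lemma HasEigenvalues.dslope_exp_ne_zero {a : Matrix (Fin 2) (Fin 2) ℂ} {p q : ℂ}
    (h : HasEigenvalues a p q) (ha : ∀ z ∈ spectrum ℂ a, z.im ∈ Set.Ioo (-Real.pi) Real.pi) :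
    dslope exp p q ≠ 0 :=
  MatrixLog.dslope_exp_ne_zero (ha p h.left_mem_spectrum) (ha q h.right_mem_spectrum)

end Eigenvalues

lemma exists_hasEigenvalues_of_exp_mul_exp {a b : Matrix (Fin 2) (Fin 2) ℂ}
    (ha : ∀ z ∈ spectrum ℂ a, z.im ∈ Set.Ioo (-Real.pi) Real.pi)
    (hb : ∀ z ∈ spectrum ℂ b, z.im ∈ Set.Ioo (-Real.pi) Real.pi)
    (h : NormedSpace.exp a * NormedSpace.exp b = NormedSpace.exp (a + b)) (hab : ¬Commute a b) :
    ∃ m l t s, (a - m • 1) * (b - l • 1) = 0 ∧ HasEigenvalues a m (m + t) ∧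
      HasEigenvalues b l (l + s) ∧ HasEigenvalues (a + b) (m + l + t) (m + l + s) ∧
      dslope exp 0 t = dslope exp 0 s ∧ dslope exp 0 s = dslope exp t s := by
  obtain ⟨p₁, q₁, ha'⟩ := exists_hasEigenvalues a
  obtain ⟨p₂, q₂, hb'⟩ := exists_hasEigenvalues b
  obtain ⟨p₃, q₃, hab'⟩ := exists_hasEigenvalues (a + b)
  obtain ⟨m, l, hml, h₁, h₂⟩ := exists_sub_mul_sub_eq_zero hab (ha'.dslope_exp_ne_zero ha)
    (hb'.dslope_exp_ne_zero hb) (by rw [← ha'.exp_eq, ← hb'.exp_eq, h, hab'.exp_eq])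
  obtain ⟨t, s, hat, hbs, hts⟩ := exists_hasEigenvalues_of_sub_mul_sub_eq_zero hml hab
  refine ⟨m, l, t, s, hml, hat, hbs, hts, ?_⟩
  obtain ⟨hm, ht⟩ := hat.exp_coeff_eq hab ha'.exp_eq
  obtain ⟨hl, hs⟩ := hbs.exp_coeff_eq (mt Commute.symm hab) hb'.exp_eq
  obtain ⟨-, hst⟩ := hts.exp_coeff_eq
    (mt (fun h => by simpa using h.sub_left (Commute.refl b)) hab) hab'.exp_eq
  have ht' : dslope exp p₁ q₁ = exp m * dslope exp 0 t := by
    simpa [ht] using dslope_exp_add_left m 0 t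
  have hs' : dslope exp p₂ q₂ = exp l * dslope exp 0 s := by
    simpa [hs] using dslope_exp_add_left l 0 s
  rw [dslope_exp_add_left, exp_add] at hst
  rw [hm, hs', hst] at h₁
  rw [hl, ht', hst] at h₂
  have hcancel := mul_ne_zero (exp_ne_zero m) (exp_ne_zero l)
  have hs'' : dslope exp 0 s = dslope exp t s :=
    mul_left_cancel₀ hcancel (by linear_combination h₁)
  have ht'' : dslope exp 0 t = dslope exp t s :=
    mul_left_cancel₀ hcancel (by linear_combination h₂)
  exact ⟨ht''.trans hs''.symm, hs''⟩

theorem commute_of_exp_mul_exp {a b : Matrix (Fin 2) (Fin 2) ℂ}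
    (ha : ∀ z ∈ spectrum ℂ a, z.im ∈ Set.Ioo (-Real.pi) Real.pi)
    (hb : ∀ z ∈ spectrum ℂ b, z.im ∈ Set.Ioo (-Real.pi) Real.pi)
    (hab : ∀ z ∈ spectrum ℂ (a + b), z.im ∈ Set.Ioo (-Real.pi) Real.pi)
    (h : NormedSpace.exp a * NormedSpace.exp b = NormedSpace.exp (a + b)) : Commute a b := by
  by_contra hc
  obtain ⟨m, l, t, s, hml, hat, hbs, hts, h₁, h₂⟩ := exists_hasEigenvalues_of_exp_mul_exp ha hb h hc
  obtain ⟨rfl, rfl⟩ := eq_of_dslope_exp_eq (a := 0) (b := t) (c := s)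
    (by simpa using abs_im_sub_lt (ha _ hat.left_mem_spectrum) (ha _ hat.right_mem_spectrum))
    (by simpa using abs_im_sub_lt (hb _ hbs.left_mem_spectrum) (hb _ hbs.right_mem_spectrum))
    (by simpa using abs_im_sub_lt (hab _ hts.left_mem_spectrum) (hab _ hts.right_mem_spectrum))
    h₁ h₂
  simp only [add_zero] at hat hbs hts
  exact hc (commute_of_hasEigenvalues_self hat hbs hts hml)

end MatrixLog

theorem theorem1 (x y : Matrix (Fin 2) (Fin 2) ℂ)
    (hx : NoNonposEigenvalue x) (hy : NoNonposEigenvalue y) (hxy : NoNonposEigenvalue (x * y))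
    (hlog : matrixLog (x * y) = matrixLog x + matrixLog y) :
    Commute x y := by
  have lx := MatrixLog.matrixLog_spec hx
  have ly := MatrixLog.matrixLog_spec hy
  have lxy := MatrixLog.matrixLog_spec hxy
  rw [hlog] at lxy
  have hcomm : Commute (matrixLog x) (matrixLog y) :=
    MatrixLog.commute_of_exp_mul_exp lx.2 ly.2 lxy.2 (by rw [lx.1, ly.1, lxy.1])
  rw [← lx.1, ← ly.1]
  open scoped Matrix.Norms.Operator in
  exact hcomm.exp
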